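/- Rings are associative, and are not assumed to be commutative or to have a unity. For a ring $R$ and an integer $n\ge 1$ let $M_n(R)$ be the set of $n\times n$ matrices with entries in $R$, and for $A=(a_{ij})\in M_n(R)$ put $$\operatorname{per} A=\sum_{\sigma\in S_n} a_{1\sigma(1)}a_{2\sigma(2)}\cdots a_{n\sigma(n)},\qquad \det A=\sum_{\sigma\in S_n}\operatorname{sgn}(\sigma)\,a_{1\sigma(1)}a_{2\sigma(2)}\cdots a_{n\sigma(n)},$$ the products being taken in the indicated order. The characteristic $\operatorname{char} R$ is the least positive integer $m$ with $ma=0$ for all $a\in R$, or $0$ if no such $m$ exists. Let $n\ge 3$. Then there exists an integer $q_0$, depending only on $n$, such that for every finite ring $R$ without zero divisors, with $|R|\ge q_0$ and $\operatorname{char} R\neq 2$, no bijective map $\Phi: M_n(R)\to M_n(R)$ satisfies $\operatorname{per} A=\det\Phi(A)$ for all $A\in M_n(R)$. -/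

import Mathlib

/-- The ordered product `f 0 * f 1 * ⋯ * f (n - 1)`, in this order, of a nonempty finite family.
It is used in rings that need not have a unity, so there is no empty product; the value `0`
at `n = 0` is only a placeholder. -/
def orderedProd {R : Type*} [Mul R] [Zero R] : (n : ℕ) → (Fin n → R) → R
  | 0, _ => 0
  | 1, f => f 0
  | n + 2, f => orderedProd (n + 1) (fun i => f i.castSucc) * f (Fin.last (n + 1))

/-- The permanent `∑ σ, a_{1 σ(1)} ⋯ a_{n σ(n)}` over an associative ring that need be neither
commutative nor unital; the factors are taken in the order of the rows. -/
def ringPer {R : Type*} [NonUnitalRing R] {n : ℕ} (A : Matrix (Fin n) (Fin n) R) : R :=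
  ∑ σ : Equiv.Perm (Fin n), orderedProd n (fun i => A i (σ i))

/-- The determinant `∑ σ, sgn(σ) a_{1 σ(1)} ⋯ a_{n σ(n)}` over an associative ring that need be
neither commutative nor unital; the factors are taken in the order of the rows. -/
def ringDet {R : Type*} [NonUnitalRing R] {n : ℕ} (A : Matrix (Fin n) (Fin n) R) : R :=
  ∑ σ : Equiv.Perm (Fin n),
    ((Equiv.Perm.sign σ : ℤˣ) : ℤ) • orderedProd n (fun i => A i (σ i))

/-- The characteristic of a ring that need not have a unity: the least positive integer `m` with
`m • a = 0` for all `a`, and `0` if there is none. -/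
noncomputable def ringCharacteristic (R : Type*) [NonUnitalRing R] : ℕ :=
  AddMonoid.exponent R

/-! A nontrivial finite ring without zero divisors is a field, say with q elements; put r = 1/q. A
bijection carrying `per` to `det` would make the two functions vanish on equally many matrices, but
singular matrices have density at least r + r² - r³, while in characteristic other than 2 the
permanent vanishes with density at most r + 9r³.

The r² comes from n - 1 rows whose maximal minors all vanish. For permanents this is rarer: fix n -
2 rows and write P_{uv} for their subpermanent omitting columns u, v. An added row b makes all
maximal subpermanents vanish only if its entries at three columns x, y, z solve a linear system with
symmetric matrix of zero diagonal and off-diagonal entries P_{xy}, P_{xz}, P_{yz}. Its determinant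
2·P_{xy}·P_{xz}·P_{yz} is generically nonzero, so three entries are determined
(`density_row_le_cube`). For minors, signs make the matrix antisymmetric, hence singular. -/

/-- The proportion of the elements of a finite type that satisfy a predicate. -/
noncomputable def density {α : Type*} [Fintype α] (p : α → Prop) : ℝ :=
  (∑ a, Set.indicator {a | p a} (fun _ => (1 : ℝ)) a) / Fintype.card α

theorem density_eq_card_div {α : Type*} [Fintype α] (p : α → Prop) :
    density p = (Nat.card {a // p a} : ℝ) / Fintype.card α := by
  classical
  unfold density
  congr 1
  simp [Set.indicator_apply, Fintype.card_subtype]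

theorem density_le_one {α : Type*} [Fintype α] (p : α → Prop) : density p ≤ 1 := by
  classical
  rw [density_eq_card_div]
  refine div_le_one_of_le₀ ?_ (by positivity)
  rw [Nat.card_eq_fintype_card]
  exact_mod_cast Fintype.card_subtype_le p

theorem density_cons {β : Type*} [Fintype β] (m : ℕ) (p : (Fin (m + 1) → β) → Prop) :
    density p =
      (∑ C : Fin m → β, density (fun b => p (Fin.cons b C))) / Fintype.card (Fin m → β) := by
  unfold density
  rw [← Finset.sum_div, div_div]
  congr 1
  · rw [← (Fin.consEquiv (fun _ : Fin (m + 1) => β)).sum_comp, Fintype.sum_prod_type,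
      Finset.sum_comm]
    rfl
  · simp [pow_succ, mul_comm]

/-- A set of functions in which the values outside `W` determine the values on `W`. -/
theorem density_le_of_determined {ι F : Type*} [Fintype ι] [DecidableEq ι] [Fintype F] [Nonempty F]
    (W : Finset ι) (p : (ι → F) → Prop)
    (h : ∀ b b', p b → p b' → (∀ i, i ∉ W → b i = b' i) → b = b') :
    density p ≤ ((Fintype.card F : ℝ)⁻¹) ^ W.card := by
  classical
  have hc : Nat.card {b // p b} ≤ Fintype.card F ^ (Fintype.card ι - W.card) := by
    have := Nat.card_le_card_of_injective
      (fun (b : {b // p b}) (i : {i // i ∉ W}) => b.1 i) (by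
        intro b b' hbb
        exact Subtype.ext (h _ _ b.2 b'.2 fun i hi => congrFun hbb ⟨i, hi⟩))
    simpa [Nat.card_eq_fintype_card, Fintype.card_subtype_compl] using this
  have hq : (0 : ℝ) < Fintype.card F := by exact_mod_cast Fintype.card_pos
  rw [density_eq_card_div, div_le_iff₀ (by exact_mod_cast Fintype.card_pos)]
  calc (Nat.card {b // p b} : ℝ) ≤ (Fintype.card F : ℝ) ^ (Fintype.card ι - W.card) := by
        exact_mod_cast hc
    _ = ((Fintype.card F : ℝ)⁻¹) ^ W.card * Fintype.card (ι → F) := by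
        rw [Fintype.card_fun, Nat.cast_pow,
          ← Nat.sub_add_cancel (Finset.card_le_univ W), pow_add, inv_pow]
        field_simp
        simp

/-! ### Vanishing of all maximal subpermanents -/

/-- The permanent of the submatrix of `A` on the columns in `S`, by expansion along the first row;
it is meaningful when `S` has as many elements as there are rows. -/
def subPer {ι F : Type*} [DecidableEq ι] [Field F] : (m : ℕ) → (Fin m → ι → F) → Finset ι → F
  | 0, _, _ => 1
  | m + 1, A, S => ∑ i ∈ S, A 0 i * subPer m (Fin.tail A) (S.erase i)

theorem subPer_cons {ι F : Type*} [DecidableEq ι] [Field F] (m : ℕ) (b : ι → F)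
    (C : Fin m → ι → F) (S : Finset ι) :
    subPer (m + 1) (Fin.cons b C : Fin (m + 1) → ι → F) S =
      ∑ i ∈ S, b i * subPer m C (S.erase i) := rfl

theorem subPer_eq_sum {ι F : Type*} [Fintype ι] [DecidableEq ι] [Field F] (m : ℕ)
    (A : Fin m → ι → F) (S : Finset ι) (hS : S.card = m) :
    subPer m A S = ∑ f : Fin m → ι,
      if Function.Injective f ∧ ∀ i, f i ∈ S then ∏ i, A i (f i) else 0 := by
  induction m generalizing S with
  | zero => simp [subPer, Function.injective_of_subsingleton]
  | succ m ih =>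
    rw [← (Fin.consEquiv (fun _ : Fin (m + 1) => ι)).sum_comp, Fintype.sum_prod_type, subPer,
      ← Finset.sum_subset (Finset.subset_univ S)]
    · refine Finset.sum_congr rfl fun i hi => ?_
      rw [ih _ _ (by rw [Finset.card_erase_of_mem hi, hS]; rfl), Finset.mul_sum]
      refine Finset.sum_congr rfl fun f _ => ?_
      have : (Function.Injective f ∧ ∀ j, f j ∈ S.erase i) ↔
          (Function.Injective (Fin.cons i f : Fin (m + 1) → ι) ∧
            ∀ j, (Fin.cons i f : Fin (m + 1) → ι) j ∈ S) := by
        rw [Fin.cons_injective_iff, Fin.forall_fin_succ]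
        simp only [Fin.cons_zero, Fin.cons_succ, Finset.mem_erase, Set.mem_range, not_exists]
        grind
      simp only [Fin.consEquiv, Equiv.coe_fn_mk, if_congr this rfl rfl, Fin.prod_univ_succ,
        Fin.cons_zero, Fin.cons_succ, mul_ite, mul_zero]
      rfl
    · intro i _ hi
      refine Finset.sum_eq_zero fun f _ => if_neg fun h => hi ?_
      simpa using h.2 0

/-- All permanents of maximal square submatrices of `A` with columns in `U` vanish. -/
def SubPerVanish {ι F : Type*} [DecidableEq ι] [Field F] (m : ℕ) (U : Finset ι)
    (A : Fin m → ι → F) : Prop :=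
  ∀ S ⊆ U, S.card = m → subPer m A S = 0

/-- Fix S with nonzero subpermanent of `C`. For each u in U \ S, expanding on S ∪ {u} gives an
equation that determines b u from the entries of b on S. -/
theorem density_row_le {ι F : Type*} [Fintype ι] [DecidableEq ι] [Field F] [Fintype F]
    (m : ℕ) (U : Finset ι) (C : Fin m → ι → F) (hC : ¬ SubPerVanish m U C) :
    density (fun b => SubPerVanish (m + 1) U (Fin.cons b C)) ≤
      ((Fintype.card F : ℝ)⁻¹) ^ (U.card - m) := by
  unfold SubPerVanish at hC
  push Not at hC
  obtain ⟨S, hSU, hSm, hS⟩ := hC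
  rw [show U.card - m = (U \ S).card by rw [Finset.card_sdiff_of_subset hSU, hSm]]
  refine density_le_of_determined _ _ fun b b' hb hb' hbb => ?_
  funext u
  by_cases hu : u ∈ U \ S
  · obtain ⟨huU, huS⟩ := Finset.mem_sdiff.1 hu
    have hsub : insert u S ⊆ U := Finset.insert_subset huU hSU
    have hcard : (insert u S).card = m + 1 := by rw [Finset.card_insert_of_notMem huS, hSm]
    have e := hb _ hsub hcard
    have e' := hb' _ hsub hcard
    rw [subPer_cons, Finset.sum_insert huS, Finset.erase_insert huS] at e e'
    have : ∑ i ∈ S, b i * subPer m C ((insert u S).erase i) =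
        ∑ i ∈ S, b' i * subPer m C ((insert u S).erase i) :=
      Finset.sum_congr rfl fun i hi => by rw [hbb i (by simp [hi])]
    refine mul_right_cancel₀ hS ?_
    linear_combination e - e' - this
  · exact hbb u hu

theorem density_subPerVanish_succ_le {ι F : Type*} [Fintype ι] [DecidableEq ι] [Field F]
    [Fintype F] (m : ℕ) (U : Finset ι) :
    density (SubPerVanish (F := F) (m + 1) U) ≤
      density (SubPerVanish (F := F) m U) + ((Fintype.card F : ℝ)⁻¹) ^ (U.card - m) := by
  have hpos : (0 : ℝ) < Fintype.card (Fin m → ι → F) := by exact_mod_cast Fintype.card_pos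
  rw [density_cons, div_le_iff₀ hpos, add_mul]
  unfold density
  rw [div_mul_cancel₀ _ hpos.ne', mul_comm _ (Fintype.card (Fin m → ι → F) : ℝ), ← nsmul_eq_mul,
    ← Finset.card_univ (α := Fin m → ι → F), ← Finset.sum_const, ← Finset.sum_add_distrib]
  refine Finset.sum_le_sum fun C _ => ?_
  by_cases hC : SubPerVanish m U C
  · rw [Set.indicator_of_mem (by exact hC)]
    exact (density_le_one _).trans (le_add_of_nonneg_right (by positivity))
  · rw [Set.indicator_of_notMem (by exact hC), zero_add]
    exact density_row_le m U C hC

/-- The factor 2 absorbs a geometric series of ratio r ≤ 1/2. -/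
theorem density_subPerVanish_le {ι F : Type*} [Fintype ι] [DecidableEq ι] [Field F]
    [Fintype F] (m : ℕ) (U : Finset ι) (hm : m ≤ U.card) :
    density (SubPerVanish (F := F) m U) ≤ 2 * ((Fintype.card F : ℝ)⁻¹) ^ (U.card - m + 1) := by
  induction m with
  | zero =>
    have : density (SubPerVanish (F := F) 0 U) = 0 := by
      have (A : Fin 0 → ι → F) : ¬ SubPerVanish 0 U A := fun h =>
        one_ne_zero (h ∅ (by simp) rfl)
      simp [density, this]
    rw [this]; positivity
  | succ m ih =>
    have h1 := density_subPerVanish_succ_le (F := F) m U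
    have h2 := ih (by omega)
    have hq : ((Fintype.card F : ℝ)⁻¹) ≤ 1 / 2 := by
      rw [one_div]
      exact inv_anti₀ two_pos (by exact_mod_cast Fintype.one_lt_card)
    have hx : 0 ≤ ((Fintype.card F : ℝ)⁻¹) ^ (U.card - m) := by positivity
    rw [show U.card - (m + 1) + 1 = U.card - m by omega]
    rw [pow_succ] at h2
    nlinarith

/-! ### The cubic bound outside characteristic 2 -/

/-- If the three subpermanents omitting two of the columns `x`, `y`, `z` do not vanish, then the
entries of an added row at `x`, `y`, `z` are determined by its other entries. -/
theorem density_row_le_cube {ι F : Type*} [Fintype ι] [DecidableEq ι] [Field F] [Fintype F]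
    (h2 : (2 : F) ≠ 0) (m : ℕ) (hm : Fintype.card ι = m + 2) (x y z : ι) (hxy : x ≠ y)
    (hxz : x ≠ z) (hyz : y ≠ z) (C : Fin m → ι → F)
    (hz : subPer m C ({x, y}ᶜ) ≠ 0) (hy : subPer m C ({x, z}ᶜ) ≠ 0)
    (hx : subPer m C ({y, z}ᶜ) ≠ 0) :
    density (fun b => SubPerVanish (m + 1) Finset.univ (Fin.cons b C)) ≤
      ((Fintype.card F : ℝ)⁻¹) ^ 3 := by
  have hW : ({x, y, z} : Finset ι).card = 3 := Finset.card_eq_three.2 ⟨x, y, z, hxy, hxz, hyz, rfl⟩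
  rw [← hW]
  refine density_le_of_determined _ _ fun b b' hb hb' hbb => ?_
  -- Subtract the expansions of b and b' on the columns other than u; only the terms at v and w
  -- survive.
  have key (u v w : ι) (huv : u ≠ v) (huw : u ≠ w) (hvw : v ≠ w)
      (hs : ({u, v, w} : Finset ι) = {x, y, z}) :
      (b v - b' v) * subPer m C ({u, v}ᶜ) + (b w - b' w) * subPer m C ({u, w}ᶜ) = 0 := by
    have hcard : ({u}ᶜ : Finset ι).card = m + 1 := by
      rw [Finset.card_compl, hm, Finset.card_singleton]; rfl
    have e := hb _ (Finset.subset_univ _) hcard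
    have e' := hb' _ (Finset.subset_univ _) hcard
    rw [subPer_cons] at e e'
    have hE (t : ι) : ({u}ᶜ : Finset ι).erase t = {u, t}ᶜ := by ext; simp; tauto
    simp only [hE] at e e'
    have : ∑ i ∈ ({u}ᶜ : Finset ι), (b i - b' i) * subPer m C ({u, i}ᶜ) =
        ∑ i ∈ ({v, w} : Finset ι), (b i - b' i) * subPer m C ({u, i}ᶜ) := by
      symm
      refine Finset.sum_subset ?_ ?_
      · intro t; simp; grind
      · intro t ht ht'
        rw [hbb t, sub_self, zero_mul]
        rw [← hs]
        simp at ht ht' ⊢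
        tauto
    rw [Finset.sum_pair hvw] at this
    rw [← this]
    simp only [sub_mul, Finset.sum_sub_distrib, e, e', sub_self]
  have ex := key x y z hxy hxz hyz rfl
  have ey := key y x z hxy.symm hyz hxz (by ext; simp; tauto)
  have ez := key z x y hxz.symm hyz.symm hxy (by ext; simp; tauto)
  rw [Finset.pair_comm y x] at ey
  rw [Finset.pair_comm z x, Finset.pair_comm z y] at ez
  have dx : b x = b' x := by
    -- Eliminating the other two differences leaves the factor 2, the only use of the
    -- characteristic.
    have : 2 * subPer m C ({x, y}ᶜ) * subPer m C ({x, z}ᶜ) * (b x - b' x) = 0 := by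
      linear_combination (-subPer m C ({y, z}ᶜ)) * ex + subPer m C ({x, z}ᶜ) * ey +
        subPer m C ({x, y}ᶜ) * ez
    exact sub_eq_zero.1 ((mul_eq_zero.1 this).resolve_left (mul_ne_zero (mul_ne_zero h2 hz) hy))
  have dy : b y = b' y := by
    have : (b y - b' y) * subPer m C ({y, z}ᶜ) = 0 := by
      linear_combination ez - subPer m C ({x, z}ᶜ) * dx
    exact sub_eq_zero.1 ((mul_eq_zero.1 this).resolve_right hx)
  have dz : b z = b' z := by
    have : (b z - b' z) * subPer m C ({y, z}ᶜ) = 0 := by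
      linear_combination ey - subPer m C ({x, y}ᶜ) * dx
    exact sub_eq_zero.1 ((mul_eq_zero.1 this).resolve_right hx)
  funext i
  by_cases hi : i ∈ ({x, y, z} : Finset ι)
  · simp at hi
    rcases hi with rfl | rfl | rfl <;> assumption
  · exact hbb i hi

/-- 9 = 2 + 6 + 1: all m-subpermanents of the lower rows vanish (2r³); one of three chosen ones
vanishes but not all do (3 · 2r · r²); none of the three vanishes (r³). -/
theorem density_subPerVanish_univ_le {ι F : Type*} [Fintype ι] [DecidableEq ι] [Field F]
    [Fintype F] (h2 : (2 : F) ≠ 0) (m : ℕ) (hm : Fintype.card ι = m + 2) (hm1 : 1 ≤ m) :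
    density (SubPerVanish (F := F) (m + 1) (Finset.univ : Finset ι)) ≤
      9 * ((Fintype.card F : ℝ)⁻¹) ^ 3 := by
  obtain ⟨x, y, z, hxy, hxz, hyz⟩ :=
    Fintype.two_lt_card_iff.1 (show 2 < Fintype.card ι by omega)
  set r := ((Fintype.card F : ℝ)⁻¹) with hr
  have hr0 : 0 ≤ r := by positivity
  have hbad (u v : ι) (huv : u ≠ v) :
      density (SubPerVanish (F := F) m ({u, v}ᶜ : Finset ι)) ≤ 2 * r := by
    have hc : ({u, v}ᶜ : Finset ι).card = m := by
      rw [Finset.card_compl, hm, Finset.card_pair huv]; rfl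
    have := density_subPerVanish_le (F := F) m ({u, v}ᶜ : Finset ι) hc.ge
    rwa [hc, Nat.sub_self, zero_add, pow_one] at this
  have hone (u v : ι) (huv : u ≠ v) (C : Fin m → ι → F) (h : subPer m C ({u, v}ᶜ) = 0) :
      SubPerVanish m ({u, v}ᶜ : Finset ι) C := by
    intro S hS hSm
    rw [Finset.eq_of_subset_of_card_le hS, h]
    rw [Finset.card_compl, hm, Finset.card_pair huv, hSm]; rfl
  have hzero : density (SubPerVanish (F := F) m (Finset.univ : Finset ι)) ≤ 2 * r ^ 3 := by
    have := density_subPerVanish_le (F := F) m (Finset.univ : Finset ι) (by simp [hm])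
    rwa [Finset.card_univ, hm, Nat.add_sub_cancel_left] at this
  have main : density (SubPerVanish (F := F) (m + 1) (Finset.univ : Finset ι)) ≤
      density (SubPerVanish (F := F) m (Finset.univ : Finset ι)) +
      r ^ 2 * (density (SubPerVanish (F := F) m ({x, y}ᶜ : Finset ι)) +
        density (SubPerVanish (F := F) m ({x, z}ᶜ : Finset ι)) +
        density (SubPerVanish (F := F) m ({y, z}ᶜ : Finset ι))) + r ^ 3 := by
    have hpos : (0 : ℝ) < Fintype.card (Fin m → ι → F) := by exact_mod_cast Fintype.card_pos
    rw [density_cons]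
    conv_rhs => unfold density
    have e (a b c d N s t : ℝ) (hN : 0 < N) : a / N + s * (b / N + c / N + d / N) + t =
        (a + s * (b + c + d) + N * t) / N := by field_simp
    rw [e _ _ _ _ _ _ _ hpos, div_le_div_iff_of_pos_right hpos, ← nsmul_eq_mul,
      ← Finset.card_univ (α := Fin m → ι → F), ← Finset.sum_const, ← Finset.sum_add_distrib,
      ← Finset.sum_add_distrib, Finset.mul_sum, ← Finset.sum_add_distrib, ← Finset.sum_add_distrib]
    refine Finset.sum_le_sum fun C _ => ?_
    have i0 (U : Finset ι) :
        0 ≤ Set.indicator {C : Fin m → ι → F | SubPerVanish m U C} (fun _ => (1 : ℝ)) C :=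
      Set.indicator_nonneg (fun _ _ => zero_le_one) _
    have hr2 : 0 ≤ r ^ 2 := by positivity
    have hr3 : 0 ≤ r ^ 3 := by positivity
    have j0 := fun U => mul_nonneg hr2 (i0 U)
    have i1 (U : Finset ι) (h : SubPerVanish m U C) :
        Set.indicator {C : Fin m → ι → F | SubPerVanish m U C} (fun _ => (1 : ℝ)) C = 1 :=
      Set.indicator_of_mem (by exact h) _
    simp only [mul_add]
    have a1 := i0 Finset.univ
    have a2 := j0 ({x, y}ᶜ)
    have a3 := j0 ({x, z}ᶜ)
    have a4 := j0 ({y, z}ᶜ)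
    by_cases hC : SubPerVanish m Finset.univ C
    · rw [i1 _ hC]
      linarith [density_le_one fun b : ι → F => SubPerVanish (m + 1) Finset.univ (Fin.cons b C)]
    have sq := density_row_le m Finset.univ C hC
    rw [Finset.card_univ, hm, Nat.add_sub_cancel_left, ← hr] at sq
    by_cases hz : subPer m C ({x, y}ᶜ) = 0
    · rw [i1 _ (hone x y hxy C hz)]; linarith
    by_cases hy : subPer m C ({x, z}ᶜ) = 0
    · rw [i1 _ (hone x z hxz C hy)]; linarith
    by_cases hx : subPer m C ({y, z}ᶜ) = 0
    · rw [i1 _ (hone y z hyz C hx)]; linarith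
    linarith [density_row_le_cube h2 m hm x y z hxy hxz hyz C hz hy hx]
  have b1 := hbad x y hxy
  have b2 := hbad x z hxz
  have b3 := hbad y z hyz
  have : r ^ 2 * (density (SubPerVanish (F := F) m ({x, y}ᶜ : Finset ι)) +
        density (SubPerVanish (F := F) m ({x, z}ᶜ : Finset ι)) +
        density (SubPerVanish (F := F) m ({y, z}ᶜ : Finset ι))) ≤ r ^ 2 * (6 * r) :=
    mul_le_mul_of_nonneg_left (by linarith) (by positivity)
  nlinarith

/-! ### Zeros of the permanent and of the determinant over a finite field -/

theorem orderedProd_eq_prod {F : Type*} [Field F] (n : ℕ) (f : Fin (n + 1) → F) :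
    orderedProd (n + 1) f = ∏ i, f i := by
  induction n with
  | zero => simp [orderedProd]
  | succ n ih => rw [Fin.prod_univ_castSucc, ← ih]; rfl

theorem ringPer_eq_subPer {F : Type*} [Field F] (n : ℕ)
    (A : Matrix (Fin (n + 1)) (Fin (n + 1)) F) :
    ringPer A = subPer (n + 1) (fun i j => A i j) Finset.univ := by
  rw [subPer_eq_sum _ _ _ (by simp)]
  simp only [Finset.mem_univ, implies_true, and_true, ringPer, orderedProd_eq_prod]
  rw [← Finset.sum_filter]
  refine Finset.sum_bij (fun σ _ => ⇑σ) ?_ ?_ ?_ ?_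
  · intro σ _
    simpa using σ.injective
  · intro σ _ τ _ h
    exact Equiv.coe_fn_injective h
  · intro f hf
    exact ⟨Equiv.ofBijective f (Finite.injective_iff_bijective.1 (by simpa using hf)),
      Finset.mem_univ _, rfl⟩
  · intro σ _
    rfl

theorem ringDet_eq_det {F : Type*} [Field F] (n : ℕ)
    (A : Matrix (Fin (n + 1)) (Fin (n + 1)) F) : ringDet A = A.det := by
  rw [← Matrix.det_transpose, Matrix.det_apply']
  simp [ringDet, orderedProd_eq_prod]

theorem density_ringPer_eq_zero_le {F : Type*} [Field F] [Fintype F] (h2 : (2 : F) ≠ 0) (n : ℕ) :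
    density (fun A : Matrix (Fin (n + 3)) (Fin (n + 3)) F => ringPer A = 0) ≤
      (Fintype.card F : ℝ)⁻¹ + 9 * ((Fintype.card F : ℝ)⁻¹) ^ 3 := by
  have hp : (fun A : Matrix (Fin (n + 3)) (Fin (n + 3)) F => ringPer A = 0) =
      SubPerVanish (F := F) (n + 3) (Finset.univ : Finset (Fin (n + 3))) := by
    funext A
    rw [ringPer_eq_subPer]
    refine propext ⟨fun h S _ hS => ?_, fun h => h _ subset_rfl (by simp)⟩
    rw [(Finset.card_eq_iff_eq_univ S).1 (by simpa using hS), h]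
  have h := density_subPerVanish_succ_le (F := F) (n + 2) (Finset.univ : Finset (Fin (n + 3)))
  have h' := density_subPerVanish_univ_le (ι := Fin (n + 3)) h2 (n + 1) (by simp) (by omega)
  rw [show (Finset.univ : Finset (Fin (n + 3))).card - (n + 2) = 1 by simp, pow_one] at h
  rw [hp]
  exact h.trans (by linarith)

/-- By the order of GL, the density is 1 minus the product of the 1 - rⁱ. Only the factors i = 1, 2
are kept, the others being at most 1. -/
theorem le_density_det_eq_zero {F : Type*} [Field F] [Fintype F] (n : ℕ) :
    (Fintype.card F : ℝ)⁻¹ + ((Fintype.card F : ℝ)⁻¹) ^ 2 - ((Fintype.card F : ℝ)⁻¹) ^ 3 ≤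
      density (fun A : Matrix (Fin (n + 2)) (Fin (n + 2)) F => A.det = 0) := by
  classical
  set q := (Fintype.card F : ℝ) with hqdef
  have hq1 : 1 ≤ q := Nat.one_le_cast.2 Fintype.card_pos
  have hq : 0 < q := by linarith
  have hcard : (Fintype.card (Matrix (Fin (n + 2)) (Fin (n + 2)) F) : ℝ) =
      ∏ _i : Fin (n + 2), q ^ (n + 2) := by
    change (Fintype.card (Fin (n + 2) → Fin (n + 2) → F) : ℝ) = _
    simp [hqdef]
  have hGL : (Nat.card {A : Matrix (Fin (n + 2)) (Fin (n + 2)) F // ¬ A.det = 0} : ℝ) =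
      ∏ i : Fin (n + 2), (q ^ (n + 2) - q ^ (i : ℕ)) := by
    have e : {A : Matrix (Fin (n + 2)) (Fin (n + 2)) F // ¬ A.det = 0} ≃
        GL (Fin (n + 2)) F :=
      { toFun := fun A => Matrix.GeneralLinearGroup.mkOfDetNeZero A.1 A.2
        invFun := fun g => ⟨g, g.det_ne_zero⟩
        left_inv := fun _ => rfl
        right_inv := fun _ => Units.ext rfl }
    rw [Nat.card_congr e, Matrix.card_GL_field, Nat.cast_prod]
    refine Finset.prod_congr rfl fun i _ => ?_
    rw [Nat.cast_sub (Nat.pow_le_pow_right Fintype.card_pos i.2.le)]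
    simp [hqdef]
  have hsum : density (fun A : Matrix (Fin (n + 2)) (Fin (n + 2)) F => A.det = 0) =
      1 - ∏ i : Fin (n + 2), (1 - q⁻¹ ^ (n + 2 - (i : ℕ))) := by
    have hpos : (0 : ℝ) < Fintype.card (Matrix (Fin (n + 2)) (Fin (n + 2)) F) := by
      exact_mod_cast Fintype.card_pos
    have hfac : ∏ i : Fin (n + 2), (1 - q⁻¹ ^ (n + 2 - (i : ℕ))) =
        (Nat.card {A : Matrix (Fin (n + 2)) (Fin (n + 2)) F // ¬ A.det = 0} : ℝ) /
          Fintype.card (Matrix (Fin (n + 2)) (Fin (n + 2)) F) := by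
      rw [hGL, hcard, ← Finset.prod_div_distrib]
      refine Finset.prod_congr rfl fun i _ => ?_
      rw [sub_div, div_self (by positivity), inv_pow, pow_sub₀ _ hq.ne' i.2.le]
      field_simp
    rw [hfac, density_eq_card_div, eq_sub_iff_add_eq, ← add_div, div_eq_one_iff_eq hpos.ne',
      Nat.card_eq_fintype_card, Nat.card_eq_fintype_card, Fintype.card_subtype_compl,
      Nat.cast_sub (Fintype.card_subtype_le _)]
    ring
  have hr1 : q⁻¹ ≤ 1 := inv_le_one_of_one_le₀ hq1
  have hr0 : 0 ≤ q⁻¹ := by positivity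
  have hle : ∏ i : Fin n, (1 - q⁻¹ ^ (n + 2 - (i : ℕ))) ≤ 1 :=
    Finset.prod_le_one (fun i _ => sub_nonneg.2 (pow_le_one₀ hr0 hr1))
      fun i _ => sub_le_self _ (by positivity)
  rw [hsum, Fin.prod_univ_castSucc, Fin.prod_univ_castSucc]
  simp only [Fin.val_castSucc, Fin.val_last]
  rw [show n + 2 - n = 2 by omega, show n + 2 - (n + 1) = 1 by omega, pow_one]
  have hx : 0 ≤ (1 - q⁻¹ ^ 2) * (1 - q⁻¹) :=
    mul_nonneg (sub_nonneg.2 (pow_le_one₀ hr0 hr1)) (sub_nonneg.2 hr1)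
  have := mul_le_mul_of_nonneg_right hle hx
  rw [mul_assoc]
  linarith

/-! ### Reduction to fields and conclusion -/

theorem density_comp_of_bijective {α : Type*} [Fintype α] (f : α → α) (hf : f.Bijective)
    (p : α → Prop) : density (fun a => p (f a)) = density p := by
  unfold density
  congr 1
  exact hf.sum_comp fun a => Set.indicator {a | p a} (fun _ => (1 : ℝ)) a

/-- A nontrivial finite ring without zero divisors is a field, by Wedderburn's little theorem. -/
theorem exists_field_of_finite_noZeroDivisors (R : Type*) [inst : NonUnitalRing R] [Finite R]
    [NoZeroDivisors R] [Nontrivial R] :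
    ∃ F : Field R, F.toDivisionRing.toRing.toNonUnitalRing = inst := by
  obtain ⟨a, ha⟩ := exists_ne (0 : R)
  have hinj (b : R) (hb : b ≠ 0) : Function.Injective (b * ·) := fun x y h => by
    have : b * (x - y) = 0 := by rw [mul_sub, sub_eq_zero]; exact h
    exact sub_eq_zero.1 ((mul_eq_zero.1 this).resolve_left hb)
  have hinj' (b : R) (hb : b ≠ 0) : Function.Injective (· * b) := fun x y h => by
    have : (x - y) * b = 0 := by rw [sub_mul, sub_eq_zero]; exact h
    exact sub_eq_zero.1 ((mul_eq_zero.1 this).resolve_right hb)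
  -- A solution of a * e = a is a left identity by cancelling a on the left, and then a right
  -- identity by cancelling a on the right.
  obtain ⟨e, he⟩ := Finite.injective_iff_surjective.1 (hinj a ha) a
  have he1 (x : R) : e * x = x := hinj a ha (by
    change a * (e * x) = a * x
    rw [← mul_assoc]; exact congrArg (· * x) he)
  have he2 (x : R) : x * e = x := hinj' a ha (by
    change x * e * a = x * a
    rw [mul_assoc, he1])
  let ring : Ring R := { inst with one := e, one_mul := he1, mul_one := he2 }
  have : IsDomain R := @NoZeroDivisors.to_isDomain R ring ‹_› ‹_›
  exact ⟨(Finite.isDomain_to_isField R).toField, rfl⟩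

theorem two_ne_zero_of_ringCharacteristic_ne_two {F : Type*} [Field F]
    (h : ringCharacteristic F ≠ 2) : (2 : F) ≠ 0 := by
  intro h2
  have hd : AddMonoid.exponent F ∣ 2 :=
    AddMonoid.exponent_dvd_of_forall_nsmul_eq_zero fun x => by simp [h2]
  rcases (Nat.dvd_prime Nat.prime_two).1 hd with h1 | h1
  · exact not_subsingleton F (AddMonoid.exp_eq_one_iff.1 h1)
  · exact h h1

theorem mainTheorem2 (n : ℕ) (hn : 3 ≤ n) :
    ∃ q₀ : ℕ, ∀ (R : Type*) [NonUnitalRing R] [Finite R] [NoZeroDivisors R],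
      q₀ ≤ Nat.card R → ringCharacteristic R ≠ 2 →
        ¬ ∃ Φ : Matrix (Fin n) (Fin n) R → Matrix (Fin n) (Fin n) R,
          Function.Bijective Φ ∧ ∀ A : Matrix (Fin n) (Fin n) R, ringPer A = ringDet (Φ A) := by
  obtain ⟨n, rfl⟩ := Nat.exists_eq_add_of_le' hn
  -- The two bounds give r² ≤ 10r³, that is q ≤ 10, whatever n is.
  refine ⟨11, fun R inst _ _ hR hchar => ?_⟩
  have : Nontrivial R := Finite.one_lt_card_iff_nontrivial.1 (by omega)
  have := Fintype.ofFinite R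
  obtain ⟨F, rfl⟩ := exists_field_of_finite_noZeroDivisors R
  rintro ⟨Φ, hΦ, h⟩
  have hper := density_ringPer_eq_zero_le (two_ne_zero_of_ringCharacteristic_ne_two hchar) n
  have hdet := le_density_det_eq_zero (F := R) (n + 1)
  simp only [h, ringDet_eq_det] at hper
  rw [density_comp_of_bijective Φ hΦ fun A => A.det = 0] at hper
  rw [Nat.card_eq_fintype_card] at hR
  have hq : (11 : ℝ) ≤ Fintype.card R := by exact_mod_cast hR
  have hr : (0 : ℝ) < (Fintype.card R : ℝ)⁻¹ := by positivity
  have hqr : (Fintype.card R : ℝ) * (Fintype.card R : ℝ)⁻¹ = 1 := mul_inv_cancel₀ (by positivity)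
  have hsmall : (Fintype.card R : ℝ)⁻¹ ^ 2 ≤ 10 * (Fintype.card R : ℝ)⁻¹ ^ 3 := by linarith
  have : 11 * (Fintype.card R : ℝ)⁻¹ ≤ 1 := hqr ▸ mul_le_mul_of_nonneg_right hq hr.le
  have : 0 < (Fintype.card R : ℝ)⁻¹ ^ 2 := by positivity
  nlinarith
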